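/- Let $M=(p_{i,j})$ be an $n\times m$ matrix of polynomials in $\mathbb{R}[t]$, and write $M=\sum_{d\ge 0}M_d\,t^d$ with real $n\times m$ matrices $M_d$. The unfolding of $M$ is the infinite block-Toeplitz matrix, with blocks indexed by pairs of nonnegative integers $(a,b)$, whose $(a,b)$ block is $M_{b-a}$ if $a\le b$ and $0$ otherwise. A real matrix is totally nonnegative if the determinants of all its finite square submatrices are nonnegative. Let $p,q\in\mathbb{R}[t]$ be nonzero polynomials all of whose roots are real, with roots $\chi_1\ge\chi_2\ge\cdots$ and $\psi_1\ge\psi_2\ge\cdots$ respectively, listed with multiplicity. We say that $p$ interlaces $q$ if either $\deg p=\deg q=k$ and $\chi_1\ge\psi_1\ge\chi_2\ge\psi_2\ge\cdots\ge\chi_k\ge\psi_k$, or $\deg p=\deg q+1=k+1$ and $\chi_1\ge\psi_1\ge\cdots\ge\chi_k\ge\psi_k\ge\chi_{k+1}$. By convention, every real-rooted polynomial (including $0$) interlaces $0$ and is interlaced by $0$. Suppose that the unfolding of $M$ is totally nonnegative. Then: 1. for all $i<i'$ and all $j$, the polynomial $p_{i',j}(t)$ interlaces $p_{i,j}(t)$;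 2. for all $i$ and all $j<j'$ with $p_{i,j}\neq 0$, the functions $t^{\deg p_{i,j}}\,p_{i,j'}(1/t)$ and $t^{\deg p_{i,j}}\,p_{i,j}(1/t)$ are polynomials in $t$, and the first interlaces the second. If instead $p_{i,j}=0$, then $p_{i,j'}$ is real-rooted. -/

import Mathlib

open Polynomial

/-- A real matrix with linearly ordered rows and columns, finite or infinite in number, is totally
nonnegative if the determinant of every finite square submatrix (rows and columns kept in
order) is nonnegative. -/
def IsTotallyNonneg {R C : Type*} [LinearOrder R] [LinearOrder C] (A : Matrix R C ℝ) : Prop :=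
  ∀ (k : ℕ) (r : Fin k ↪o R) (c : Fin k ↪o C), 0 ≤ (A.submatrix r c).det

/-- The unfolding of an `n × m` matrix of polynomials `M = ∑ d, M_d t ^ d`: the infinite block
upper triangular Toeplitz matrix whose `(a, b)` block is `M_(b - a)` for `a ≤ b` and `0` otherwise.
The pair `(a, i)` is row `i` of the `a`-th block of rows; pairs are ordered lexicographically,
which is the order of the rows (columns) of the block matrix from top to bottom (left to right). -/
noncomputable def unfolding {n m : ℕ} (M : Matrix (Fin n) (Fin m) ℝ[X]) :
    Matrix (ℕ ×ₗ Fin n) (ℕ ×ₗ Fin m) ℝ :=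
  fun r c =>
    if (ofLex r).1 ≤ (ofLex c).1 then
      (M (ofLex r).2 (ofLex c).2).coeff ((ofLex c).1 - (ofLex r).1)
    else 0

/-- Two nonzero real polynomials `p`, `q` whose roots are all real, listed with multiplicity as
`χ 0 ≥ χ 1 ≥ …` and `ψ 0 ≥ ψ 1 ≥ …`, with `deg p = deg q` or `deg p = deg q + 1` and
`χ 0 ≥ ψ 0 ≥ χ 1 ≥ ψ 1 ≥ …` up to the last root of `p` and of `q`. That the number of listed
roots is the degree says that all roots are real. -/
def RootsInterlace (p q : ℝ[X]) : Prop :=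
  p ≠ 0 ∧ q ≠ 0 ∧ (p.natDegree = q.natDegree ∨ p.natDegree = q.natDegree + 1) ∧
    ∃ χ ψ : ℕ → ℝ,
      p.roots = (Multiset.range p.natDegree).map χ ∧
      q.roots = (Multiset.range q.natDegree).map ψ ∧
      (∀ k, k < q.natDegree → ψ k ≤ χ k) ∧
      (∀ k, k + 1 < p.natDegree → χ (k + 1) ≤ ψ k)

/-- `p` (weakly) interlaces `q`. By convention every real-rooted polynomial interlaces `0` and is
interlaced by `0` (`Splits` over `ℝ` means that all roots are real; it holds for `0`). -/
def Interlaces (p q : ℝ[X]) : Prop :=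
  RootsInterlace p q ∨ (q = 0 ∧ p.Splits) ∨ (p = 0 ∧ q.Splits)

/-- The polynomial `q` is `t ^ d * p (1 / t)`. -/
def IsReversal (d : ℕ) (p q : ℝ[X]) : Prop :=
  ∀ t : ℝ, t ≠ 0 → q.eval t = t ^ d * p.eval (1 / t)

/-! ### Total nonnegativity and variation diminution -/

/-! The engine is the Aissen–Schoenberg–Whitney theorem, `splits_of_isTotallyNonneg_toeplitz`: a
polynomial with totally nonnegative Toeplitz matrix is real-rooted. It follows from variation
diminution. A nonreal zero $z$ yields a vector $\operatorname{Im}(e^{i\varphi}z^c)$ with few sign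
changes that the matrix kills, and a small perturbation of it has an image that alternates too
often.

Let $p$ stand above $q$ in a column. Consecutive rows of the unfolding may be merged with
nonnegative weights, so all $ap+bq$ and $aq+btp$ with $a,b\ge 0$ are again real-rooted, hence, when
nonzero, free of zeros in the upper half-plane. Along the half circle $|x|e^{i\tau}$ this keeps
$\arg q-\arg p$ strictly between $\tau-\pi$ and $\pi$. At the endpoint $x<0$ that difference is
$\pi$ times the excess of roots of $q$ over roots of $p$ in $(x,0]$, so the excess is 0 or 1
(`IsTotallyNonneg.countP_roots`). Holding for all nonroots $x<0$, this is interlacing.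

For two entries of a row, transposition reverses the coefficients and turns the row into a column,
and a $2\times2$ minor bounds the degree. -/

theorem IsTotallyNonneg.submatrix {R C R' C' : Type*} [LinearOrder R] [LinearOrder C]
    [LinearOrder R'] [LinearOrder C'] {A : Matrix R C ℝ} (h : IsTotallyNonneg A)
    {f : R' → R} {g : C' → C} (hf : StrictMono f) (hg : StrictMono g) :
    IsTotallyNonneg (A.submatrix f g) := fun k r c =>
  h k (r.trans (OrderEmbedding.ofStrictMono f hf)) (c.trans (OrderEmbedding.ofStrictMono g hg))

theorem IsTotallyNonneg.transpose {R C : Type*} [LinearOrder R] [LinearOrder C]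
    {A : Matrix R C ℝ} (h : IsTotallyNonneg A) : IsTotallyNonneg A.transpose := fun k r c => by
  have := h k c r
  rwa [← Matrix.det_transpose, Matrix.transpose_submatrix] at this

theorem IsTotallyNonneg.nonneg {R C : Type*} [LinearOrder R] [LinearOrder C]
    {A : Matrix R C ℝ} (h : IsTotallyNonneg A) (r : R) (c : C) : 0 ≤ A r c := by
  have := h 1 (OrderEmbedding.ofStrictMono (fun _ => r) (Subsingleton.strictMono _))
    (OrderEmbedding.ofStrictMono (fun _ => c) (Subsingleton.strictMono _))
  simpa using this

/-- Nonnegative combinations of consecutive groups of rows have nonnegative minors. -/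
theorem IsTotallyNonneg.det_sum_rows_nonneg {R C ι : Type*} [LinearOrder R] [LinearOrder C]
    [Fintype ι] {A : Matrix R C ℝ} (h : IsTotallyNonneg A) {k : ℕ} (w : Fin k → ι → ℝ)
    (ρ : Fin k → ι → R) (hw : ∀ i u, 0 ≤ w i u)
    (hρ : ∀ i i' u u', i < i' → w i u ≠ 0 → w i' u' ≠ 0 → ρ i u < ρ i' u') (c : Fin k ↪o C) :
    0 ≤ (Matrix.of fun i j => ∑ u, w i u * A (ρ i u) (c j)).det := by
  classical
  -- Multilinear expansion in the rows. Each choice `f` with nonzero weight picks strictly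
  -- increasing rows, so its term is a weighted minor of `A`.
  have key : (Matrix.of fun i j => ∑ u, w i u * A (ρ i u) (c j)).det =
      ∑ f : Fin k → ι, (∏ i, w i (f i)) *
        (Matrix.of fun i j => A (ρ i (f i)) (c j)).det := by
    have h1 : (Matrix.of fun i j => ∑ u, w i u * A (ρ i u) (c j)) =
        fun i => ∑ u, w i u • (fun j => A (ρ i u) (c j)) := by
      ext i j
      simp [Finset.sum_apply]
    have h2 := (Matrix.detRowAlternating (R := ℝ) (n := Fin k)).toMultilinearMap.map_sum
      (fun i u => w i u • (fun j => A (ρ i u) (c j)))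
    rw [h1]
    refine Eq.trans h2 (Finset.sum_congr rfl fun f _ => ?_)
    exact (Matrix.detRowAlternating (R := ℝ) (n := Fin k)).toMultilinearMap.map_smul_univ
      (fun i => w i (f i)) (fun i => (fun j => A (ρ i (f i)) (c j)))
  rw [key]
  refine Finset.sum_nonneg fun f _ => ?_
  by_cases hf : ∀ i, w i (f i) ≠ 0
  · refine mul_nonneg (Finset.prod_nonneg fun i _ => hw _ _) ?_
    have hm : StrictMono fun i => ρ i (f i) := fun i i' hi => hρ _ _ _ _ hi (hf _) (hf _)
    exact h k (OrderEmbedding.ofStrictMono _ hm) c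
  · push Not at hf
    obtain ⟨i, hi⟩ := hf
    rw [Finset.prod_eq_zero (Finset.mem_univ i) hi, zero_mul]

/-- A totally nonnegative matrix with one more row than columns has no strictly alternating vector
in its range. -/
theorem IsTotallyNonneg.not_alternating_mulVec {L : ℕ} {B : Matrix (Fin (L + 1)) (Fin L) ℝ}
    (h : IsTotallyNonneg B) (x : Fin L → ℝ) :
    ¬ ∀ i : Fin (L + 1), 0 < (-1) ^ (i : ℕ) * (B.mulVec x) i := by
  induction L with
  | zero =>
    intro H
    simpa [Matrix.mulVec, dotProduct] using H 0
  | succ L ih =>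
    intro H
    set y := B.mulVec x with hy
    -- Prepending `y` to `B` gives a singular matrix. In the expansion along the column `y` every
    -- term is nonnegative, so every maximal minor of `B` vanishes.
    let M' : Matrix (Fin (L + 2)) (Fin (L + 2)) ℝ := Matrix.of fun i => Fin.cons (y i) (B i)
    have hdet : M'.det = 0 := by
      rw [← Matrix.exists_mulVec_eq_zero_iff]
      refine ⟨Fin.cons 1 (-x), fun h0 => by simpa using congrFun h0 0, ?_⟩
      ext i
      simp [M', Matrix.mulVec, dotProduct, Fin.sum_univ_succ, hy]
    rw [Matrix.det_succ_column_zero] at hdet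
    have hminor : ∀ i : Fin (L + 2), M'.submatrix i.succAbove Fin.succ =
        B.submatrix i.succAbove id := fun i => by ext a b; simp [M']
    have hnn : ∀ i : Fin (L + 2), 0 ≤ (B.submatrix i.succAbove id).det := fun i =>
      h _ i.succAboveOrderEmb (OrderEmbedding.ofStrictMono id strictMono_id)
    have hz := (Finset.sum_eq_zero_iff_of_nonneg (fun i _ => by
      rw [hminor]; exact mul_nonneg (H i).le (hnn i))).1 hdet (Fin.last _) (Finset.mem_univ _)
    -- The last row is the one dropped, so that the remaining rows still alternate from sign $+$.
    rw [hminor] at hz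
    have hB : (B.submatrix (Fin.last (L + 1)).succAbove id).det = 0 :=
      (mul_eq_zero.1 hz).resolve_left (H _).ne'
    obtain ⟨v, hv, hBv⟩ := Matrix.exists_mulVec_eq_zero_iff.2 hB
    obtain ⟨k, hk⟩ : ∃ k, v k ≠ 0 := by
      by_contra! hcon
      exact hv (funext hcon)
    -- The kernel vector `v` clears coordinate `k` of `x` without changing the image in the
    -- remaining rows, so column `k` can be deleted.
    refine ih (B := B.submatrix (Fin.last (L + 1)).succAbove k.succAbove)
      (h.submatrix (Fin.strictMono_succAbove _) (Fin.strictMono_succAbove _))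
      (fun l => x (k.succAbove l) - x k / v k * v (k.succAbove l)) fun i => ?_
    have h1 := H ((Fin.last (L + 1)).succAbove i)
    have h2 := congrFun hBv i
    convert h1 using 2
    · simp
    · simp only [hy, Matrix.mulVec, dotProduct, Matrix.submatrix_apply, id, Pi.zero_apply] at h2 ⊢
      rw [Fin.sum_univ_succAbove _ k] at h2 ⊢
      simp only [mul_sub, Finset.sum_sub_distrib]
      have h3 : ∑ l : Fin L, B ((Fin.last (L + 1)).succAbove i) (k.succAbove l) *
          (x k / v k * v (k.succAbove l)) = x k / v k *
          ∑ l : Fin L, B ((Fin.last (L + 1)).succAbove i) (k.succAbove l) * v (k.succAbove l) := by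
        rw [Finset.mul_sum]
        exact Finset.sum_congr rfl fun _ _ => by ring
      rw [h3, eq_neg_of_add_eq_zero_right h2]
      field_simp
      ring

/-- Variation diminution: if the entries of `x` fall into `L` consecutive blocks of constant sign,
then `A x` has no `L + 1` strictly alternating entries. -/
theorem IsTotallyNonneg.not_alternating {R : Type*} [LinearOrder R] {N L : ℕ}
    {A : Matrix R (Fin N) ℝ} (h : IsTotallyNonneg A) (x : Fin N → ℝ) (b : Fin N → Fin L)
    (hb : Monotone b) (σ : Fin L → ℝ) (hx : ∀ c, x c = σ (b c) * |x c|)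
    (r : Fin (L + 1) ↪o R) :
    ¬ ∀ i : Fin (L + 1), 0 < (-1) ^ (i : ℕ) * ∑ c, A (r i) c * x c := by
  intro H
  -- Each block of columns is merged with weights $|x_c|$, so that `A x = B σ`.
  let B : Matrix (Fin (L + 1)) (Fin L) ℝ := Matrix.of fun i l =>
    ∑ c, (if b c = l then |x c| else 0) * A (r i) c
  have hB : IsTotallyNonneg B := by
    intro k r' c'
    have := h.transpose.det_sum_rows_nonneg (k := k) (ι := Fin N)
      (fun l c => if b c = c' l then |x c| else 0) (fun _ c => c)
      (fun i u => by split_ifs <;> positivity)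
      (fun i i' u u' hi hu hu' => by
        have hu1 : b u = c' i := by by_contra hne; simp [hne] at hu
        have hu2 : b u' = c' i' := by by_contra hne; simp [hne] at hu'
        by_contra! hle
        have := hb hle
        rw [hu1, hu2] at this
        exact absurd (c'.lt_iff_lt.2 hi) (not_lt.2 this)) (r'.trans r)
    rw [← Matrix.det_transpose] at this
    exact this
  refine hB.not_alternating_mulVec σ fun i => ?_
  convert H i using 2
  simp only [Matrix.mulVec, dotProduct, B, Matrix.of_apply, Finset.sum_mul]
  rw [Finset.sum_comm]
  refine Finset.sum_congr rfl fun c _ => ?_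
  rw [Finset.sum_eq_single (b c)]
  · rw [if_pos rfl]
    conv_rhs => rw [hx c]
    ring
  · intro l _ hl
    rw [if_neg (Ne.symm hl)]
    ring
  · simp

/-! ### Toeplitz matrices of polynomials and real-rootedness -/

/-- The upper triangular Toeplitz matrix of the coefficients of `p`. -/
noncomputable def toeplitz (p : ℝ[X]) : Matrix ℕ ℕ ℝ := fun r c =>
  if r ≤ c then p.coeff (c - r) else 0

/-- Row $s$ is supported in columns $s,\dots,s+\deg p$, so truncation at `N` loses nothing. -/
theorem sum_toeplitz_smul_pow {S : Type*} [CommRing S] [Algebra ℝ S] (p : ℝ[X]) (z : S) {s N : ℕ}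
    (hN : s + p.natDegree < N) :
    ∑ c : Fin N, toeplitz p s c • z ^ (c : ℕ) = z ^ s * aeval z p := by
  obtain ⟨m, rfl⟩ : ∃ m, N = s + m := ⟨N - s, by omega⟩
  rw [Finset.sum_range (fun c => toeplitz p s c • z ^ c) |>.symm, Finset.sum_range_add,
    Finset.sum_eq_zero, zero_add, aeval_eq_sum_range' (n := m) (by omega), Finset.mul_sum]
  · refine Finset.sum_congr rfl fun i _ => ?_
    simp [toeplitz, pow_add]
  · intro c hc
    have : ¬ s ≤ c := by simpa using hc
    simp [toeplitz, this]

theorem splits_of_aeval_ne_zero {p : ℝ[X]} (h : ∀ z : ℂ, 0 < z.im → aeval z p ≠ 0) :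
    p.Splits := by
  refine Splits.of_splits_map (algebraMap ℝ ℂ) (IsAlgClosed.splits _) fun z hz => ?_
  have hz0 : aeval z p = 0 := by
    have := (mem_roots'.1 hz).2
    rwa [IsRoot, eval_map_algebraMap] at this
  rcases lt_trichotomy z.im 0 with him | him | him
  · refine absurd ?_ (h (starRingEnd ℂ z) (by simpa using him))
    rw [aeval_conj, hz0, map_zero]
  · exact ⟨z.re, by apply Complex.ext <;> simp [him]⟩
  · exact absurd hz0 (h z him)

theorem neg_one_zpow_floor_mul_sin_nonneg (α : ℝ) :
    0 ≤ (-1 : ℝ) ^ ⌊α / Real.pi⌋ * Real.sin α := by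
  have hπ := Real.pi_pos
  set m := ⌊α / Real.pi⌋ with hm
  have h1 : (m : ℝ) * Real.pi ≤ α := by
    rw [← le_div_iff₀ hπ]; exact Int.floor_le _
  have h2 : α < (m + 1) * Real.pi := by
    rw [← div_lt_iff₀ hπ]; exact Int.lt_floor_add_one _
  have h3 : Real.sin α = (-1) ^ m * Real.sin (α - m * Real.pi) := by
    rw [← Real.sin_add_int_mul_pi, sub_add_cancel]
  rw [h3, ← mul_assoc, ← mul_zpow]
  norm_num
  exact Real.sin_nonneg_of_nonneg_of_le_pi (by linarith) (by linarith)

/-- Only countably many phases are excluded. -/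
theorem exists_sin_add_nat_mul_ne_zero (θ : ℝ) :
    ∃ φ : ℝ, ∀ k : ℕ, Real.sin (φ + k * θ) ≠ 0 := by
  by_contra! h
  refine Set.not_countable_univ (α := ℝ)
    ((Set.countable_range fun a : ℕ × ℤ => (a.2 : ℝ) * Real.pi - a.1 * θ).mono fun φ _ => ?_)
  obtain ⟨k, hk⟩ := h φ
  obtain ⟨m, hm⟩ := Real.sin_eq_zero_iff.1 hk
  exact ⟨(k, m), by simp only; linarith⟩

/-- A polynomial whose Toeplitz matrix is totally nonnegative is real-rooted
(Aissen, Schoenberg and Whitney). -/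
theorem splits_of_isTotallyNonneg_toeplitz {p : ℝ[X]} (h : IsTotallyNonneg (toeplitz p)) :
    p.Splits := by
  rcases eq_or_ne p 0 with rfl | hp0
  · exact Splits.zero
  refine splits_of_aeval_ne_zero fun z hz hz0 => ?_
  -- The negative point `u` supplies the perturbation: the vector $p(u)u^c$ has image $p(u)^2u^s$,
  -- which strictly alternates in $s$.
  obtain ⟨u, hu, hpu⟩ : ∃ u : ℝ, u < 0 ∧ p.eval u ≠ 0 := by
    obtain ⟨u, hu, hu'⟩ := (Set.Iio_infinite (0 : ℝ)).exists_notMem_finset p.roots.toFinset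
    exact ⟨u, hu, fun h0 => hu' (by simp [hp0, h0])⟩
  have hπ := Real.pi_pos
  have hz' : z ≠ 0 := by rintro rfl; simp at hz
  set θ := z.arg with hθ
  have hθ0 : 0 ≤ θ := Complex.arg_nonneg_iff.2 hz.le
  have hθπ : θ < Real.pi := (Complex.arg_le_pi z).lt_of_ne fun he => by
    rw [Complex.arg_eq_pi_iff] at he
    exact hz.ne' he.2
  obtain ⟨φ, hφ⟩ := exists_sin_add_nat_mul_ne_zero θ
  have hρ : 0 < ‖z‖ := norm_pos_iff.2 hz'
  have him : ∀ k : ℕ, (Complex.exp (φ * Complex.I) * z ^ k).im =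
      ‖z‖ ^ k * Real.sin (φ + k * θ) := fun k => by
    conv_lhs => rw [← Complex.norm_mul_exp_arg_mul_I z]
    rw [mul_pow, ← Complex.exp_nat_mul, mul_left_comm, ← Complex.exp_add, ← Complex.ofReal_pow,
      Complex.im_ofReal_mul,
      show (φ * Complex.I + k * (z.arg * Complex.I) : ℂ) =
        ((φ + k * θ : ℝ) : ℂ) * Complex.I by push_cast; ring, Complex.exp_ofReal_mul_I_im]
  set n := p.natDegree
  -- Rows $0,\dots,L$ involve columns up to $L+n$, over which the phase advances by $(L+n)\theta$.
  -- Since $\theta<\pi$, this makes at most `L` sign blocks once `L` is large.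
  obtain ⟨L, hL⟩ : ∃ L : ℕ, (L + n) * (θ / Real.pi) + 1 < L := by
    have hq : 0 < 1 - θ / Real.pi := by
      have := (div_lt_one hπ).2 hθπ
      linarith
    obtain ⟨L, hL⟩ := exists_nat_gt ((n * (θ / Real.pi) + 1) / (1 - θ / Real.pi))
    refine ⟨L, ?_⟩
    rw [div_lt_iff₀ hq] at hL
    linarith
  let N := L + n + 1
  let fl : ℕ → ℤ := fun c => ⌊(φ + c * θ) / Real.pi⌋
  have hfl : Monotone fl := fun c d hcd => Int.floor_le_floor (by gcongr)
  -- No sine vanishes and there are finitely many columns, so a small `δ` preserves all signs.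
  obtain ⟨δ, hδ, hδs⟩ : ∃ δ : ℝ, 0 < δ ∧ ∀ c : Fin N, 0 < (-1 : ℝ) ^ fl c *
      (‖z‖ ^ (c : ℕ) * Real.sin (φ + c * θ) + δ * p.eval u * u ^ (c : ℕ)) := by
    have hev : ∀ᶠ δ in nhds (0 : ℝ), ∀ c : Fin N, 0 < (-1 : ℝ) ^ fl c *
      (‖z‖ ^ (c : ℕ) * Real.sin (φ + c * θ) + δ * p.eval u * u ^ (c : ℕ)) := by
      rw [Filter.eventually_all]
      intro c
      have hc : ContinuousAt (fun δ : ℝ => (-1 : ℝ) ^ fl c *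
        (‖z‖ ^ (c : ℕ) * Real.sin (φ + c * θ) + δ * p.eval u * u ^ (c : ℕ))) 0 := by fun_prop
      refine hc.tendsto.eventually_const_lt ?_
      have h1 := neg_one_zpow_floor_mul_sin_nonneg (φ + c * θ)
      have h2 : (-1 : ℝ) ^ fl c * Real.sin (φ + c * θ) ≠ 0 :=
        mul_ne_zero (zpow_ne_zero _ (by norm_num)) (hφ c)
      have h3 := mul_pos (pow_pos hρ (c : ℕ)) (lt_of_le_of_ne h1 h2.symm)
      simp only [zero_mul, add_zero]
      linarith
    obtain ⟨δ, h1, h2⟩ := ((hev.filter_mono nhdsWithin_le_nhds).and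
      (self_mem_nhdsWithin (s := Set.Ioi (0 : ℝ)))).exists
    exact ⟨δ, h2, h1⟩
  have hb : ∀ c : Fin N, (fl c - fl 0).toNat < L := fun c => by
    rw [Int.toNat_lt (sub_nonneg.2 (hfl (Nat.zero_le _)))]
    have h1 : (fl c : ℝ) ≤ (φ + (c : ℕ) * θ) / Real.pi := Int.floor_le _
    have h2 : (φ + (0 : ℕ) * θ) / Real.pi < fl 0 + 1 := Int.lt_floor_add_one _
    have h3 : ((c : ℕ) : ℝ) ≤ L + n := by exact_mod_cast Nat.lt_succ_iff.1 c.2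
    have h4 : ((c : ℕ) : ℝ) * (θ / Real.pi) ≤ (L + n) * (θ / Real.pi) := by gcongr
    have h5 : (φ + (c : ℕ) * θ) / Real.pi = (φ + (0 : ℕ) * θ) / Real.pi +
        (c : ℕ) * (θ / Real.pi) := by push_cast; ring
    have : ((fl c - fl 0 : ℤ) : ℝ) < (L : ℝ) := by
      push_cast
      linarith
    exact_mod_cast this
  refine (h.submatrix (f := id) (g := fun c : Fin N => (c : ℕ)) strictMono_id
    (fun _ _ => id)).not_alternating
    (fun c => ‖z‖ ^ (c : ℕ) * Real.sin (φ + c * θ) + δ * p.eval u * u ^ (c : ℕ))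
    (fun c => ⟨(fl c - fl 0).toNat, hb c⟩)
    (fun c d hcd => Int.toNat_le_toNat (sub_le_sub_right (hfl hcd) _))
    (fun l => (-1 : ℝ) ^ (fl 0 + (l : ℕ))) (fun c => ?_)
    (OrderEmbedding.ofStrictMono (fun s : Fin (L + 1) => (s : ℕ)) fun _ _ => id) fun s => ?_
  · have h0 : fl 0 + ((fl c - fl 0).toNat : ℤ) = fl c := by
      rw [Int.toNat_of_nonneg (sub_nonneg.2 (hfl (Nat.zero_le _)))]; ring
    have h1 := hδs c
    simp only [h0]
    rcases Int.even_or_odd (fl c) with he | he <;> rw [he.neg_one_zpow] at h1 ⊢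
    · rw [one_mul] at h1 ⊢
      rw [abs_of_pos h1]
    · rw [abs_of_neg (by linarith)]
      ring
  · have hs : (s : ℕ) + p.natDegree < N := by
      have := s.2
      simp only [N, n]
      omega
    have hsum : ∑ c : Fin N, toeplitz p s c *
        (‖z‖ ^ (c : ℕ) * Real.sin (φ + c * θ) + δ * p.eval u * u ^ (c : ℕ)) =
        δ * p.eval u * (u ^ (s : ℕ) * p.eval u) := by
      have h1 := sum_toeplitz_smul_pow p z hs
      have h2 := sum_toeplitz_smul_pow p u hs
      rw [hz0, mul_zero] at h1
      have h3 : ∑ c : Fin N, toeplitz p s c * (‖z‖ ^ (c : ℕ) * Real.sin (φ + c * θ)) = 0 := by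
        have h4 := congrArg (fun w => (Complex.exp (φ * Complex.I) * w).im) h1
        simp only [Finset.mul_sum, mul_zero, Complex.zero_im, Complex.im_sum] at h4
        rw [← h4]
        refine Finset.sum_congr rfl fun c _ => ?_
        rw [mul_smul_comm, Complex.smul_im, him, smul_eq_mul]
      simp only [mul_add, Finset.sum_add_distrib, h3, zero_add]
      rw [coe_aeval_eq_eval] at h2
      rw [← h2, Finset.mul_sum]
      refine Finset.sum_congr rfl fun c _ => ?_
      rw [smul_eq_mul]
      ring
    have hpos : 0 < δ * p.eval u ^ 2 * (-u) ^ (s : ℕ) := by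
      have := neg_pos.2 hu
      positivity
    refine hpos.trans_eq ?_
    refine Eq.trans ?_ (congrArg (fun y => (-1 : ℝ) ^ (s : ℕ) * y) hsum).symm
    rw [neg_pow]
    ring

theorem IsTotallyNonneg.coeff_nonneg {p : ℝ[X]} (h : IsTotallyNonneg (toeplitz p)) (k : ℕ) :
    0 ≤ p.coeff k := by
  simpa [toeplitz] using h.nonneg 0 k

theorem IsTotallyNonneg.nonpos_of_mem_roots {p : ℝ[X]} (h : IsTotallyNonneg (toeplitz p))
    {x : ℝ} (hx : x ∈ p.roots) : x ≤ 0 := by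
  by_contra! hpos
  obtain ⟨hp, hroot⟩ := mem_roots'.1 hx
  have h1 : 0 < p.eval x := by
    rw [eval_eq_sum_range]
    refine Finset.sum_pos' (fun i _ => mul_nonneg (h.coeff_nonneg i) (pow_nonneg hpos.le i))
      ⟨p.natDegree, by simp, mul_pos ?_ (pow_pos hpos _)⟩
    exact lt_of_le_of_ne (h.coeff_nonneg _) (leadingCoeff_ne_zero.2 hp).symm
  exact h1.ne' hroot

/-! ### Pairs of polynomials -/

/-- The unfolding of the column `(p, q)`. -/
noncomputable def stacked (p q : ℝ[X]) : Matrix (ℕ ×ₗ Fin 2) ℕ ℝ := fun r c =>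
  toeplitz (![p, q] (ofLex r).2) (ofLex r).1 c

theorem strictMono_toLex_right {n : ℕ} (u : Fin n) :
    StrictMono fun s : ℕ => (toLex (s, u) : ℕ ×ₗ Fin n) := fun _ _ hst =>
  Prod.Lex.toLex_lt_toLex.2 (Or.inl hst)

namespace IsTotallyNonneg

variable {p q : ℝ[X]}

theorem toeplitz_left (h : IsTotallyNonneg (stacked p q)) : IsTotallyNonneg (toeplitz p) :=
  h.submatrix (strictMono_toLex_right 0) strictMono_id

theorem toeplitz_right (h : IsTotallyNonneg (stacked p q)) : IsTotallyNonneg (toeplitz q) :=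
  h.submatrix (strictMono_toLex_right 1) strictMono_id

theorem toeplitz_add (h : IsTotallyNonneg (stacked p q)) {a b : ℝ} (ha : 0 ≤ a) (hb : 0 ≤ b) :
    IsTotallyNonneg (toeplitz (C a * p + C b * q)) := fun k r c => by
  have := h.det_sum_rows_nonneg (k := k) (fun _ => ![a, b]) (fun i (u : Fin 2) => toLex (r i, u))
    (fun i u => by fin_cases u <;> simpa)
    (fun i i' u u' hi _ _ => Prod.Lex.toLex_lt_toLex.2 (Or.inl (r.strictMono hi))) c
  convert this using 2
  ext i j
  simp only [Matrix.submatrix_apply, Matrix.of_apply, Fin.sum_univ_two, stacked, toeplitz]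
  by_cases hle : r i ≤ c j <;> simp [hle]

/-- The row of $q$ in block $r$ is directly followed by the row of $p$ in block $r+1$, and a shift
by one block is multiplication by $t$. -/
theorem toeplitz_X_mul_add (h : IsTotallyNonneg (stacked p q)) {a b : ℝ} (ha : 0 ≤ a)
    (hb : 0 ≤ b) : IsTotallyNonneg (toeplitz (C a * q + C b * (X * p))) := fun k r c => by
  have := h.det_sum_rows_nonneg (k := k) (fun _ => ![a, b])
    (fun i (u : Fin 2) => ![toLex (r i, 1), toLex (r i + 1, 0)] u)
    (fun i u => by fin_cases u <;> simpa)
    (fun i i' u u' hi _ _ => by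
      have := r.strictMono hi
      fin_cases u <;> fin_cases u' <;> simp [Prod.Lex.toLex_lt_toLex] <;> omega) c
  convert this using 2
  ext i j
  simp only [Matrix.submatrix_apply, Matrix.of_apply, Fin.sum_univ_two, stacked, toeplitz]
  rcases lt_trichotomy (r i) (c j) with hlt | heq | hgt
  · obtain ⟨d, hd⟩ : ∃ d, c j = r i + (d + 1) := ⟨c j - (r i + 1), by omega⟩
    have e : r i + (d + 1) - (r i + 1) = d := by omega
    simp [hd, e, coeff_X_mul]
  · simp [heq]
  · have h1 : ¬ r i ≤ c j := by omega
    have h2 : ¬ r i + 1 ≤ c j := by omega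
    simp [h1, h2]

end IsTotallyNonneg

/-! ### Arguments along the upper half-plane -/

/-- The sum of the arguments of `w - a` for `a ∈ s`, where `w` is in the closed upper half-plane. -/
noncomputable def argSum (s : Multiset ℝ) (w : ℂ) : ℝ :=
  (s.map fun a : ℝ => Real.arccos ((w - a).re / ‖w - a‖)).sum

/-- The arccosine form has no branch cut: it is continuous up to the real axis away from the roots.
-/
theorem continuousOn_argSum {X : Type*} [TopologicalSpace X] {f : X → ℂ} {t : Set X}
    (hf : ContinuousOn f t) (s : Multiset ℝ) (hs : ∀ a ∈ s, ∀ x ∈ t, f x ≠ a) :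
    ContinuousOn (fun x => argSum s (f x)) t := by
  induction s using Multiset.induction_on with
  | empty => simpa [argSum] using continuousOn_const
  | cons a s ih =>
    simp only [argSum, Multiset.map_cons, Multiset.sum_cons]
    refine ContinuousOn.add ?_ (ih fun b hb => hs b (Multiset.mem_cons_of_mem hb))
    refine Real.continuous_arccos.comp_continuousOn (ContinuousOn.div ?_ ?_ fun x hx => ?_)
    · exact Complex.continuous_re.comp_continuousOn (hf.sub continuousOn_const)
    · exact (hf.sub continuousOn_const).norm
    · exact norm_ne_zero_iff.2 (sub_ne_zero.2 (hs a (Multiset.mem_cons_self _ _) x hx))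

/-- A root to the right of `x` contributes $\pi$, a root to the left $0$; arguments on the axis thus
count roots. -/
theorem argSum_ofReal (s : Multiset ℝ) {x : ℝ} (hx : x ∉ s) :
    argSum s x = Real.pi * s.countP (x < ·) := by
  induction s using Multiset.induction_on with
  | empty => simp [argSum]
  | cons a s ih =>
    have hxa : x ≠ a := fun h => hx (h ▸ Multiset.mem_cons_self _ _)
    have ih' := ih fun h => hx (Multiset.mem_cons_of_mem h)
    simp only [argSum, Multiset.map_cons, Multiset.sum_cons] at ih' ⊢
    rw [ih', ← Complex.ofReal_sub, Complex.ofReal_re, Complex.norm_real, Real.norm_eq_abs]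
    rcases hxa.lt_or_gt with h | h
    · have : (x - a) / |x - a| = -1 := by
        rw [abs_of_neg (sub_neg.2 h), div_neg, div_self (sub_ne_zero.2 hxa)]
      rw [this, Real.arccos_neg_one, Multiset.countP_cons_of_pos _ h]
      push_cast
      ring
    · have : (x - a) / |x - a| = 1 := by
        rw [abs_of_pos (sub_pos.2 h), div_self (sub_ne_zero.2 hxa)]
      rw [this, Real.arccos_one, Multiset.countP_cons_of_neg _ h.not_gt, zero_add]

theorem prod_sub_eq_exp_argSum (s : Multiset ℝ) {w : ℂ} (hw : 0 < w.im) :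
    ∃ r : ℝ, 0 < r ∧ (s.map fun a : ℝ => w - (a : ℂ)).prod = r * Complex.exp (argSum s w * Complex.I) := by
  induction s using Multiset.induction_on with
  | empty => exact ⟨1, one_pos, by simp [argSum]⟩
  | cons a s ih =>
    obtain ⟨r, hr, h⟩ := ih
    have him : 0 < (w - a).im := by simpa using hw
    have hne : w - a ≠ 0 := fun h0 => by simp [h0] at him
    refine ⟨‖w - a‖ * r, mul_pos (norm_pos_iff.2 hne) hr, ?_⟩
    have h1 := Complex.norm_mul_exp_arg_mul_I (w - a)
    rw [Complex.arg_of_im_nonneg_of_ne_zero him.le hne] at h1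
    rw [Multiset.map_cons, Multiset.prod_cons, h]
    conv_lhs => rw [← h1]
    simp only [argSum, Multiset.map_cons, Multiset.sum_cons]
    push_cast
    rw [add_mul, Complex.exp_add]
    ring

theorem aeval_eq_exp_argSum {p : ℝ[X]} (hp : p.Splits) (hlc : 0 < p.leadingCoeff) {w : ℂ}
    (hw : 0 < w.im) :
    ∃ r : ℝ, 0 < r ∧ aeval w p = r * Complex.exp (argSum p.roots w * Complex.I) := by
  obtain ⟨r, hr, h⟩ := prod_sub_eq_exp_argSum p.roots hw
  refine ⟨p.leadingCoeff * r, mul_pos hlc hr, ?_⟩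
  conv_lhs => rw [hp.eq_prod_roots]
  rw [map_mul, aeval_C, map_multiset_prod, Multiset.map_map]
  simp only [Function.comp_def, map_sub, aeval_X, aeval_C, Complex.coe_algebraMap]
  rw [h]
  push_cast
  ring

theorem aeval_ne_zero_of_splits {p : ℝ[X]} (hp : p.Splits) (hlc : 0 < p.leadingCoeff) {w : ℂ}
    (hw : 0 < w.im) : aeval w p ≠ 0 := by
  obtain ⟨r, hr, h⟩ := aeval_eq_exp_argSum hp hlc hw
  rw [h]
  exact mul_ne_zero (by exact_mod_cast hr.ne') (Complex.exp_ne_zero _)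

theorem IsTotallyNonneg.leadingCoeff_pos {p : ℝ[X]} (h : IsTotallyNonneg (toeplitz p))
    (hp : p ≠ 0) : 0 < p.leadingCoeff :=
  lt_of_le_of_ne (h.coeff_nonneg _) (leadingCoeff_ne_zero.2 hp).symm

theorem IsTotallyNonneg.aeval_ne_zero {p : ℝ[X]} (h : IsTotallyNonneg (toeplitz p))
    (hp : p ≠ 0) {w : ℂ} (hw : 0 < w.im) : aeval w p ≠ 0 :=
  aeval_ne_zero_of_splits (splits_of_isTotallyNonneg_toeplitz h) (h.leadingCoeff_pos hp) hw

theorem add_ne_zero_of_coeff_nonneg {f g : ℝ[X]} (hf : f ≠ 0) (hf' : ∀ k, 0 ≤ f.coeff k)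
    (hg : ∀ k, 0 ≤ g.coeff k) : f + g ≠ 0 := fun h => by
  refine hf (Polynomial.ext fun k => ?_)
  have h1 := congrArg (fun r => r.coeff k) h
  simp only [coeff_add, coeff_zero] at h1 ⊢
  linarith [hf' k, hg k]

/-- Counting the roots of `p` and `q` in `(x, 0]` when the unfolding of `(p, q)` is totally
nonnegative. -/
theorem IsTotallyNonneg.countP_roots {p q : ℝ[X]} (h : IsTotallyNonneg (stacked p q))
    (hp : p ≠ 0) (hq : q ≠ 0) {x : ℝ} (hx : x < 0) (hxp : x ∉ p.roots) (hxq : x ∉ q.roots) :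
    p.roots.countP (x < ·) ≤ q.roots.countP (x < ·) ∧
      q.roots.countP (x < ·) ≤ p.roots.countP (x < ·) + 1 := by
  have hπ := Real.pi_pos
  have hTp := h.toeplitz_left
  have hTq := h.toeplitz_right
  let z : ℝ → ℂ := fun τ => ((-x : ℝ) : ℂ) * Complex.exp (τ * Complex.I)
  have hz : Continuous z := by fun_prop
  have hzim : ∀ τ, 0 < τ → τ < Real.pi → 0 < (z τ).im := fun τ h0 h1 => by
    simp only [z]
    rw [Complex.im_ofReal_mul, Complex.exp_ofReal_mul_I_im]
    exact mul_pos (neg_pos.2 hx) (Real.sin_pos_of_pos_of_lt_pi h0 h1)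
  have hzne : ∀ a : ℝ, a ≤ 0 → a ≠ x → ∀ τ, z τ ≠ a := fun a ha hax τ hτ => hax <| by
    have := congrArg norm hτ
    simp only [z] at this
    rw [norm_mul, Complex.norm_exp_ofReal_mul_I, mul_one, Complex.norm_real, Complex.norm_real,
      Real.norm_eq_abs, Real.norm_eq_abs, abs_neg, abs_of_neg hx, abs_of_nonpos ha] at this
    linarith
  have hcont : ∀ s : Multiset ℝ, (∀ a ∈ s, a ≤ 0) → x ∉ s →
      Continuous fun τ => argSum s (z τ) := fun s hs hxs => by
    rw [← continuousOn_univ]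
    exact continuousOn_argSum hz.continuousOn s fun a ha τ _ =>
      hzne a (hs a ha) (fun hax => hxs (hax ▸ ha)) τ
  have hzero : ∀ s : Multiset ℝ, (∀ a ∈ s, a ≤ 0) → argSum s (z 0) = 0 := fun s hs => by
    have hz0 : z 0 = ((-x : ℝ) : ℂ) := by simp [z]
    rw [hz0, argSum_ofReal s fun hm => by linarith [hs _ hm], Multiset.countP_eq_zero.2, Nat.cast_zero,
      mul_zero]
    intro a ha
    linarith [hs a ha]
  have hpi : z Real.pi = (x : ℂ) := by simp [z]
  have hp0 : ∀ a ∈ p.roots, a ≤ 0 := fun a ha => hTp.nonpos_of_mem_roots ha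
  have hq0 : ∀ a ∈ q.roots, a ≤ 0 := fun a ha => hTq.nonpos_of_mem_roots ha
  -- The relative argument of $q$ and $p$ along the half circle from $-x$ to $x$; no root lies on
  -- the circle.
  let f : ℝ → ℝ := fun τ => argSum q.roots (z τ) - argSum p.roots (z τ)
  have hf : Continuous f := (hcont _ hq0 hxq).sub (hcont _ hp0 hxp)
  have hf0 : f 0 = 0 := by simp only [f]; rw [hzero _ hp0, hzero _ hq0, sub_zero]
  have hfpi : f Real.pi =
      Real.pi * (q.roots.countP (x < ·) - p.roots.countP (x < ·)) := by
    simp only [f]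
    rw [hpi, argSum_ofReal _ hxp, argSum_ofReal _ hxq, mul_sub]
  have hpol : ∀ τ, 0 < τ → τ < Real.pi → ∃ r t : ℝ, 0 < r ∧ 0 < t ∧
      aeval (z τ) p = r * Complex.exp (argSum p.roots (z τ) * Complex.I) ∧
      aeval (z τ) q = t * Complex.exp (argSum q.roots (z τ) * Complex.I) := fun τ h0 h1 => by
    obtain ⟨r, hr, hr'⟩ := aeval_eq_exp_argSum (splits_of_isTotallyNonneg_toeplitz hTp)
      (hTp.leadingCoeff_pos hp) (hzim τ h0 h1)
    obtain ⟨t, ht, ht'⟩ := aeval_eq_exp_argSum (splits_of_isTotallyNonneg_toeplitz hTq)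
      (hTq.leadingCoeff_pos hq) (hzim τ h0 h1)
    exact ⟨r, t, hr, ht, hr', ht'⟩
  -- If `f τ = π`, then $p$ and $q$ point in opposite directions at `z τ`, and a positive
  -- combination of them vanishes there.
  have hne1 : ∀ τ, 0 < τ → τ < Real.pi → f τ ≠ Real.pi := fun τ h0 h1 hfτ => by
    obtain ⟨r, t, hr, ht, hr', ht'⟩ := hpol τ h0 h1
    refine (h.toeplitz_add ht.le hr.le).aeval_ne_zero (add_ne_zero_of_coeff_nonneg
      (mul_ne_zero (C_ne_zero.2 ht.ne') hp) (fun k => ?_) fun k => ?_) (hzim τ h0 h1) ?_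
    · rw [coeff_C_mul]; exact mul_nonneg ht.le (hTp.coeff_nonneg k)
    · rw [coeff_C_mul]; exact mul_nonneg hr.le (hTq.coeff_nonneg k)
    · have : argSum q.roots (z τ) = argSum p.roots (z τ) + Real.pi := by
        simp only [f] at hfτ
        linarith
      rw [this] at ht'
      rw [map_add, map_mul, map_mul, aeval_C, aeval_C, hr', ht', Complex.ofReal_add, add_mul,
        Complex.exp_add, Complex.exp_pi_mul_I]
      simp only [Complex.coe_algebraMap]
      ring
  -- Here $tp$ and $q$ would be opposite; the weight $-x=|z|$ accounts for the factor $t$.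
  have hne2 : ∀ τ, 0 < τ → τ < Real.pi → f τ - τ ≠ -Real.pi := fun τ h0 h1 hfτ => by
    obtain ⟨r, t, hr, ht, hr', ht'⟩ := hpol τ h0 h1
    refine (h.toeplitz_X_mul_add (mul_pos (neg_pos.2 hx) hr).le ht.le).aeval_ne_zero
      (add_ne_zero_of_coeff_nonneg
      (mul_ne_zero (C_ne_zero.2 (mul_pos (neg_pos.2 hx) hr).ne') hq) (fun k => ?_) fun k => ?_)
      (hzim τ h0 h1) ?_
    · rw [coeff_C_mul]; exact mul_nonneg (mul_pos (neg_pos.2 hx) hr).le (hTq.coeff_nonneg k)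
    · rw [coeff_C_mul]
      refine mul_nonneg ht.le ?_
      cases k with
      | zero => simp
      | succ k => rw [coeff_X_mul]; exact hTp.coeff_nonneg k
    · have : argSum p.roots (z τ) = argSum q.roots (z τ) + Real.pi - τ := by
        simp only [f] at hfτ
        linarith
      rw [this] at hr'
      simp only [map_add, map_mul, aeval_C, aeval_X]
      rw [hr', ht', Complex.ofReal_sub, Complex.ofReal_add, sub_mul, add_mul,
        Complex.exp_sub, Complex.exp_add, Complex.exp_pi_mul_I]
      have := Complex.exp_ne_zero (τ * Complex.I)
      simp only [Complex.coe_algebraMap, z]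
      push_cast
      field_simp
      ring
  have hle : f Real.pi ≤ Real.pi := by
    by_contra! hgt
    obtain ⟨τ, ⟨h0, h1⟩, hτ⟩ := intermediate_value_Icc hπ.le hf.continuousOn
      (show Real.pi ∈ Set.Icc (f 0) (f Real.pi) from ⟨by rw [hf0]; exact hπ.le, hgt.le⟩)
    refine hne1 τ (h0.lt_of_ne ?_) (h1.lt_of_ne ?_) hτ
    · rintro rfl; linarith
    · rintro rfl; linarith
  have hge : 0 ≤ f Real.pi := by
    by_contra! hlt
    obtain ⟨τ, ⟨h0, h1⟩, hτ⟩ := intermediate_value_Icc' hπ.le (hf.sub continuous_id).continuousOn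
      (show -Real.pi ∈ Set.Icc (f Real.pi - Real.pi) (f 0 - 0) from
        ⟨by linarith, by rw [hf0]; linarith⟩)
    simp only [Pi.sub_apply, id] at hτ
    refine hne2 τ (h0.lt_of_ne ?_) (h1.lt_of_ne ?_) hτ
    · rintro rfl; linarith
    · rintro rfl; linarith
  rw [hfpi] at hle hge
  have h1 := nonneg_of_mul_nonneg_right hge hπ
  have h2 := le_of_mul_le_mul_left (hle.trans_eq (mul_one _).symm) hπ
  constructor
  · exact_mod_cast sub_nonneg.1 h1
  · have : (q.roots.countP (x < ·) : ℝ) ≤ p.roots.countP (x < ·) + 1 := by linarith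
    exact_mod_cast this

/-! ### Interlacing -/

/-- In decreasing order, the elements above `y` form an initial segment; this trades inequalities
between roots for inequalities between counts. -/
theorem Multiset.exists_antitone_enum (s : Multiset ℝ) :
    ∃ χ : ℕ → ℝ, s = (Multiset.range s.card).map χ ∧
      ∀ k < s.card, ∀ y, y < χ k ↔ k < s.countP (y < ·) := by
  set l := s.sort (· ≥ ·) with hl
  have hls : (l : Multiset ℝ) = s := s.sort_eq _
  have hlen : l.length = s.card := by rw [← hls, Multiset.coe_card]
  have hmono : ∀ i j, i ≤ j → j < s.card → l.getD j 0 ≤ l.getD i 0 := fun i j hij hj => by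
    have hj' : j < l.length := hlen ▸ hj
    rw [List.getD_eq_getElem _ _ hj', List.getD_eq_getElem _ _ (hij.trans_lt hj')]
    rcases hij.eq_or_lt with rfl | hlt
    · exact le_rfl
    · exact List.pairwise_iff_getElem.1 (s.pairwise_sort (· ≥ ·)) i j _ _ hlt
  have hs : s = (Multiset.range s.card).map fun k => l.getD k 0 := by
    conv_lhs => rw [← hls]
    rw [← Multiset.coe_range, Multiset.map_coe, ← hlen]
    congr 1
    refine List.ext_getElem (by simp) fun i h1 h2 => ?_
    simp [h1]
  refine ⟨fun k => l.getD k 0, hs, fun k hk y => ?_⟩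
  have hcount : s.countP (y < ·) = ((Finset.range s.card).filter fun i => y < l.getD i 0).card := by
    conv_lhs => rw [hs]
    rw [Multiset.countP_map]
    rfl
  rw [hcount]
  constructor
  · intro hy
    calc k < (Finset.range (k + 1)).card := by simp
      _ ≤ _ := Finset.card_le_card fun i hi => by
        have hi' : i ≤ k := Nat.lt_succ_iff.1 (Finset.mem_range.1 hi)
        exact Finset.mem_filter.2 ⟨Finset.mem_range.2 (hi'.trans_lt hk),
          hy.trans_le (hmono i k hi' hk)⟩
  · intro hc
    by_contra! hy
    refine absurd hc (not_lt.2 ?_)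
    calc _ ≤ (Finset.range k).card := Finset.card_le_card fun i hi => by
          obtain ⟨h1, h2⟩ := Finset.mem_filter.1 hi
          rw [Finset.mem_range] at h1 ⊢
          by_contra! hki
          exact absurd h2 (not_lt.2 ((hmono k i hki h1).trans hy))
      _ = k := Finset.card_range k

/-- A violated inequality leaves a gap between two roots; a nonroot in the gap contradicts the
counts. A point below all roots compares the degrees. -/
theorem rootsInterlace_of_countP {p q : ℝ[X]} (hp : p ≠ 0) (hq : q ≠ 0) (hps : p.Splits)
    (hqs : q.Splits) (hp0 : ∀ a ∈ p.roots, a ≤ 0) (hq0 : ∀ a ∈ q.roots, a ≤ 0)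
    (h : ∀ x < 0, x ∉ p.roots → x ∉ q.roots →
      q.roots.countP (x < ·) ≤ p.roots.countP (x < ·) ∧
      p.roots.countP (x < ·) ≤ q.roots.countP (x < ·) + 1) :
    RootsInterlace p q := by
  have hcard : q.roots.card ≤ p.roots.card ∧ p.roots.card ≤ q.roots.card + 1 := by
    obtain ⟨m, hm⟩ := (p.roots + q.roots).toFinset.bddBelow
    have hm' : ∀ a ∈ p.roots + q.roots, min m 0 - 1 < a := fun a ha => by
      have := hm (Finset.mem_coe.2 (Multiset.mem_toFinset.2 ha))
      linarith [min_le_left m 0]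
    have hmp : ∀ a ∈ p.roots, min m 0 - 1 < a := fun a ha =>
      hm' a (Multiset.mem_add.2 (Or.inl ha))
    have hmq : ∀ a ∈ q.roots, min m 0 - 1 < a := fun a ha =>
      hm' a (Multiset.mem_add.2 (Or.inr ha))
    have := h (min m 0 - 1) (by linarith [min_le_right m 0]) (fun hx => lt_irrefl _ (hmp _ hx))
      fun hx => lt_irrefl _ (hmq _ hx)
    rwa [Multiset.countP_eq_card.2 hmp, Multiset.countP_eq_card.2 hmq] at this
  obtain ⟨χ, hχ, hχ'⟩ := p.roots.exists_antitone_enum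
  obtain ⟨ψ, hψ, hψ'⟩ := q.roots.exists_antitone_enum
  have hbetween : ∀ a b : ℝ, a < b → b ≤ 0 →
      ∃ y, a < y ∧ y < b ∧ y < 0 ∧ y ∉ p.roots ∧ y ∉ q.roots := fun a b hab hb => by
    obtain ⟨y, hy, hy'⟩ := (Set.Ioo_infinite hab).exists_notMem_finset (p.roots + q.roots).toFinset
    rw [Multiset.mem_toFinset, Multiset.mem_add, not_or] at hy'
    exact ⟨y, hy.1, hy.2, hy.2.trans_le hb, hy'⟩
  have hmemχ : ∀ k < p.roots.card, χ k ∈ p.roots := fun k hk => by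
    rw [hχ]; exact Multiset.mem_map_of_mem _ (Multiset.mem_range.2 hk)
  have hmemψ : ∀ k < q.roots.card, ψ k ∈ q.roots := fun k hk => by
    rw [hψ]; exact Multiset.mem_map_of_mem _ (Multiset.mem_range.2 hk)
  refine ⟨hp, hq, ?_, χ, ψ, ?_, ?_, fun k hk => ?_, fun k hk => ?_⟩
  · rw [hps.natDegree_eq_card_roots, hqs.natDegree_eq_card_roots]; omega
  · rwa [hps.natDegree_eq_card_roots]
  · rwa [hqs.natDegree_eq_card_roots]
  · rw [hqs.natDegree_eq_card_roots] at hk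
    by_contra! hlt
    obtain ⟨y, h1, h2, hy0, hyp, hyq⟩ := hbetween _ _ hlt (hq0 _ (hmemψ k hk))
    have h3 := (hψ' k hk y).1 h2
    have h4 := (hχ' k (hk.trans_le hcard.1) y).2 (h3.trans_le (h y hy0 hyp hyq).1)
    exact lt_asymm h1 h4
  · rw [hps.natDegree_eq_card_roots] at hk
    by_contra! hlt
    obtain ⟨y, h1, h2, hy0, hyp, hyq⟩ := hbetween _ _ hlt (hp0 _ (hmemχ _ hk))
    have h3 := (hχ' _ hk y).1 h2
    have h4 := (hψ' k (by omega) y).2 (by have := (h y hy0 hyp hyq).2; omega)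
    exact lt_asymm h1 h4

theorem interlaces_of_isTotallyNonneg_stacked {p q : ℝ[X]} (h : IsTotallyNonneg (stacked p q)) :
    Interlaces q p := by
  have hps := splits_of_isTotallyNonneg_toeplitz h.toeplitz_left
  have hqs := splits_of_isTotallyNonneg_toeplitz h.toeplitz_right
  by_cases hp : p = 0
  · exact Or.inr (Or.inl ⟨hp, hqs⟩)
  by_cases hq : q = 0
  · exact Or.inr (Or.inr ⟨hq, hps⟩)
  exact Or.inl (rootsInterlace_of_countP hq hp hqs hps
    (fun a ha => h.toeplitz_right.nonpos_of_mem_roots ha)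
    (fun a ha => h.toeplitz_left.nonpos_of_mem_roots ha)
    fun x hx hxq hxp => h.countP_roots hp hq hx hxp hxq)

/-! ### Unfoldings -/

theorem isReversal_reflect {N : ℕ} {p : ℝ[X]} (h : p.natDegree ≤ N) :
    IsReversal N p (reflect N p) := fun t ht => by
  have := invertibleOfNonzero (inv_ne_zero ht)
  have h1 := eval₂_reflect_mul_pow (RingHom.id ℝ) t⁻¹ N p h
  rw [invOf_eq_inv, inv_inv, inv_pow, ← eval, ← eval] at h1
  rw [one_div, ← h1]
  field_simp

section Unfolding

variable {n m : ℕ} {M : Matrix (Fin n) (Fin m) ℝ[X]}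

theorem strictMono_lex_pair {n : ℕ} {i i' : Fin n} (hi : i < i') (N : ℕ) :
    StrictMono fun r : ℕ ×ₗ Fin 2 =>
      (toLex ((ofLex r).1 + N, ![i, i'] (ofLex r).2) : ℕ ×ₗ Fin n) := by
  intro r s hrs
  rw [Prod.Lex.lt_iff] at hrs
  refine Prod.Lex.toLex_lt_toLex.2 ?_
  rcases hrs with hrs | ⟨h1, h2⟩
  · exact Or.inl (Nat.add_lt_add_right hrs N)
  · refine Or.inr ⟨by simp [h1], ?_⟩
    revert h2
    generalize (ofLex r).2 = u
    generalize (ofLex s).2 = v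
    fin_cases u <;> fin_cases v <;> simp [hi]

theorem isTotallyNonneg_stacked_of_column (hM : IsTotallyNonneg (unfolding M)) {i i' : Fin n}
    (hi : i < i') (j : Fin m) : IsTotallyNonneg (stacked (M i j) (M i' j)) := by
  convert hM.submatrix (strictMono_lex_pair hi 0) (strictMono_toLex_right j) using 1
  ext r c
  obtain ⟨⟨a, u⟩, rfl⟩ := toLex.surjective r
  fin_cases u <;> rfl

theorem isTotallyNonneg_toeplitz_entry (hM : IsTotallyNonneg (unfolding M)) (i : Fin n)
    (j : Fin m) : IsTotallyNonneg (toeplitz (M i j)) :=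
  hM.submatrix (strictMono_toLex_right i) (strictMono_toLex_right j)

/-- Transposing sends the offset $d$ to $-d$; starting `N` column blocks later makes it $N-d$, the
index in the reversed polynomial. -/
theorem isTotallyNonneg_stacked_reflect (hM : IsTotallyNonneg (unfolding M)) (i : Fin n)
    {j j' : Fin m} (hj : j < j') {N : ℕ} (h : (M i j).natDegree ≤ N)
    (h' : (M i j').natDegree ≤ N) :
    IsTotallyNonneg (stacked (reflect N (M i j)) (reflect N (M i j'))) := by
  convert (hM.submatrix (strictMono_toLex_right i) (strictMono_lex_pair hj N)).transpose using 1
  have key : ∀ (f : ℝ[X]), f.natDegree ≤ N → ∀ a b : ℕ,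
      toeplitz (reflect N f) b a = if a ≤ b + N then f.coeff (b + N - a) else 0 := by
    intro f hf a b
    unfold toeplitz
    rw [coeff_reflect]
    by_cases hba : b ≤ a
    · rw [if_pos hba]
      by_cases hab : a ≤ b + N
      · rw [if_pos hab, revAt_le (by omega)]
        congr 1
        omega
      -- `revAt` fixes indices above `N`, where `f` has no coefficients.
      · rw [if_neg hab, revAt_eq_self_of_lt (by omega), coeff_eq_zero_of_natDegree_lt (by omega)]
    · rw [if_neg hba, if_pos (by omega), coeff_eq_zero_of_natDegree_lt (by omega)]
  ext r a
  obtain ⟨⟨b, u⟩, rfl⟩ := toLex.surjective r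
  fin_cases u
  · exact key _ h a b
  · exact key _ h' a b

/-- Otherwise, with $y=\deg p_{i,j'}>N=\deg p_{i,j}$, row $i$ of blocks $0$ and $y-N$ and columns
$j,j'$ of block $y$ give a minor with upper left entry $0$ and the two positive leading coefficients
on the antidiagonal, so it is negative. -/
theorem natDegree_le_of_isTotallyNonneg_unfolding (hM : IsTotallyNonneg (unfolding M)) (i : Fin n)
    {j j' : Fin m} (hj : j < j') (h0 : M i j ≠ 0) : (M i j').natDegree ≤ (M i j).natDegree := by
  by_contra! hlt
  set N := (M i j).natDegree with hN
  set y := (M i j').natDegree with hy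
  have hp := (isTotallyNonneg_toeplitz_entry hM i j).leadingCoeff_pos h0
  have hq := (isTotallyNonneg_toeplitz_entry hM i j').leadingCoeff_pos
    (fun h => by simp [hy, h] at hlt)
  have hr : StrictMono ![(toLex (0, i) : ℕ ×ₗ Fin n), toLex (y - N, i)] := by
    rw [Fin.strictMono_iff_lt_succ]
    intro k
    fin_cases k
    simp [Prod.Lex.toLex_lt_toLex]
    omega
  have hc : StrictMono ![(toLex (y, j) : ℕ ×ₗ Fin m), toLex (y, j')] := by
    rw [Fin.strictMono_iff_lt_succ]
    intro k
    fin_cases k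
    simp [Prod.Lex.toLex_lt_toLex, hj]
  have := hM 2 (OrderEmbedding.ofStrictMono _ hr) (OrderEmbedding.ofStrictMono _ hc)
  have e : y - (y - N) = N := by omega
  rw [Matrix.det_fin_two] at this
  simp [unfolding, e, coeff_eq_zero_of_natDegree_lt (hN ▸ hlt)] at this
  have h2 : 0 < (M i j').coeff y * (M i j).coeff N := mul_pos hq hp
  linarith

end Unfolding

theorem corollary4p6 (n m : ℕ) (M : Matrix (Fin n) (Fin m) ℝ[X])
    (hM : IsTotallyNonneg (unfolding M)) :
    (∀ (i i' : Fin n) (j : Fin m), i < i' → Interlaces (M i' j) (M i j)) ∧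
    (∀ (i : Fin n) (j j' : Fin m), j < j' →
      (M i j ≠ 0 →
        ∃ q r : ℝ[X], IsReversal (M i j).natDegree (M i j') q ∧
          IsReversal (M i j).natDegree (M i j) r ∧ Interlaces q r) ∧
      (M i j = 0 → (M i j').Splits)) := by
  refine ⟨fun i i' j hi =>
    interlaces_of_isTotallyNonneg_stacked (isTotallyNonneg_stacked_of_column hM hi j),
    fun i j j' hj => ⟨fun h0 => ?_, fun _ =>
      splits_of_isTotallyNonneg_toeplitz (isTotallyNonneg_toeplitz_entry hM i j')⟩⟩
  have hdeg := natDegree_le_of_isTotallyNonneg_unfolding hM i hj h0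
  exact ⟨_, _, isReversal_reflect hdeg, isReversal_reflect le_rfl,
    interlaces_of_isTotallyNonneg_stacked (isTotallyNonneg_stacked_reflect hM i hj le_rfl hdeg)⟩
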